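/- **Setting.** Let $G=(V,E)$ be a finite simple bipartite graph with parts $A,B$, with edge weights $w_e\ge 0$ and total weight $W=\sum_{e\in E}w_e$, and let $\sigma$ be a probability distribution on $V$ whose support $S=\{u:\sigma_u\ne0\}$ is contained in $A$. A *flow* from $\sigma$ to a non-empty set $M\subseteq V$ is a function $p$ on oriented edges with $p_{uv}=-p_{vu}$ and $\sum_{v:\,uv\in E}p_{uv}=\sigma_u$ for every $u\notin M$; its energy is $\sum_{e\in E}p_e^2/w_e$ (where $0/0=0$ and $x/0=\infty$ for $x>0$), and the effective resistance $R_{\sigma,M}\in[0,\infty]$ is the infimum of the energies of the flows from $\sigma$ to $M$. Let $\mathcal M$ be a family of subsets of $V$ (the possible marked sets), and let $R>0$ be such that $R_{\sigma,M}\le R$ for every non-empty $M\in\mathcal M$. **Walk.** Fix constants $C_1,C>0$. The quantum walk acts on the space with orthonormal basis $\{|u\rangle:u\in S\}\cup\{|e\rangle:e\in E\}$. Put $$\psi_u=\sqrt{\tfrac{\sigma_u}{C_1R}}\,|u\rangle+\sum_{uv\in E}\sqrt{w_{uv}}\,|uv\rangle ,$$ without the first term if $u\notin S$. For the marked set $M$,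 let $D_u$ be the identity if $u\in M$, and the reflection about the orthogonal complement of $\psi_u$ in the span of $|u\rangle$ (if $u\in S$) and of the $|uv\rangle$ with $uv\in E$ if $u\notin M$. Let $R_A=\bigoplus_{u\in A}D_u$ and $R_B=\bigoplus_{u\in B}D_u$, extended by the identity. One step of the walk is $R_BR_A$. **Algorithm.** Start in $\sum_{u\in S}\sqrt{\sigma_u}\,|u\rangle$ and measure whether $u$ is marked. If it is, output "marked vertices exist". Otherwise execute phase estimation on $R_BR_A$ with precision $\delta=1/(C\sqrt{RW})$, and output "marked vertices exist" if the eigenvalue is estimated to be $1$ (the reported phase in $(-\pi,\pi]$ has absolute value at most $\delta$), and "no marked vertices" otherwise. Here phase estimation is the standard circuit with the quantum Fourier transform over $\mathbb Z/T$, $T=\lceil 16\pi/\delta\rceil$, and $T-1$ controlled applications of $R_BR_A$. **Theorem.** There are universal constants $C_1,C,K>0$ such that, for all $G,w,\sigma,\mathcal M,R$ as above: 1. for every non-empty $M\in\mathcal M$, if the marked set is $M$, then the algorithm outputs "marked vertices exist" with probability at least $2/3$; 2. if there is some non-empty $M\in\mathcal M$ with $\sum_{u\in M}\sigma_u<2/3$,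 then, if there is no marked vertex, the algorithm outputs "no marked vertices" with probability at least $2/3$; 3. the algorithm uses at most $K\sqrt{RW}$ (controlled) steps of the quantum walk. -/

import Mathlib

noncomputable section

namespace QuantumWalk

open scoped Classical ENNReal

/-! ### Weighted bipartite graphs, flows, effective resistance -/

/-- The data of the walk that is known in advance: a finite simple bipartite graph with parts
`A`, `B`, nonnegative edge weights, and an initial probability distribution supported on `A`. -/
structure Network (V : Type*) [Fintype V] where
  /-- the graph -/
  graph : SimpleGraph V
  /-- the part of the bipartition that carries the initial distribution -/
  A : Finset V
  /-- the other part -/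
  B : Finset V
  bipartite : graph.IsBipartiteWith (A : Set V) (B : Set V)
  /-- the edge weights (only the values on edges matter) -/
  w : Sym2 V → ℝ
  w_nonneg : ∀ e ∈ graph.edgeSet, 0 ≤ w e
  /-- the initial distribution -/
  σ : V → ℝ
  σ_nonneg : ∀ u, 0 ≤ σ u
  σ_sum : ∑ u, σ u = 1
  σ_supp : ∀ u, σ u ≠ 0 → u ∈ A

variable {V : Type*} [Fintype V]

namespace Network

/-- The total weight `W`. -/
def totalWeight (X : Network V) : ℝ := ∑ e ∈ X.graph.edgeFinset, X.w e

/-- A flow from `σ` to `M`: an antisymmetric function on oriented edges such that the net flow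
out of each non-marked vertex `u` is `σ u`. (The values of `p` at non-adjacent pairs play no
role anywhere.) -/
structure Flow (X : Network V) (M : Finset V) where
  /-- the flow along the oriented edge `uv` -/
  p : V → V → ℝ
  antisymm : ∀ u v, p u v = -p v u
  conservation : ∀ u, u ∉ M → X.σ u = ∑ v ∈ X.graph.neighborFinset u, p u v

/-- The square of the flow through an unoriented edge. -/
def Flow.sq {X : Network V} {M : Finset V} (f : X.Flow M) : Sym2 V → ℝ :=
  Sym2.lift ⟨fun u v => f.p u v ^ 2, fun u v => by
    show f.p u v ^ 2 = f.p v u ^ 2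
    rw [f.antisymm u v, neg_sq]⟩

/-- The energy `∑ p_e ^ 2 / w_e`, in `[0, ∞]`: an edge of weight `0` contributes `0` if it
carries no flow and `∞` otherwise. -/
def Flow.energy {X : Network V} {M : Finset V} (f : X.Flow M) : ℝ≥0∞ :=
  ∑ e ∈ X.graph.edgeFinset, ENNReal.ofReal (f.sq e) / ENNReal.ofReal (X.w e)

/-- The effective resistance from `σ` to `M` (`∞` if there is no flow of finite energy). -/
def effectiveResistance (X : Network V) (M : Finset V) : ℝ≥0∞ := ⨅ f : X.Flow M, f.energy

/-! ### The quantum walk -/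

/-- The computational basis: `|u⟩` for `u` in the support of `σ`, and `|e⟩` for the edges `e`. -/
abbrev Label (X : Network V) : Type _ := {u : V // X.σ u ≠ 0} ⊕ X.graph.edgeSet

/-- The space of the quantum walk. -/
abbrev Space (X : Network V) : Type _ := EuclideanSpace ℂ X.Label

/-- The initial state `∑ √σ_u |u⟩`. -/
def initial (X : Network V) : X.Space :=
  WithLp.toLp 2 (Sum.elim (fun u => ((√(X.σ u) : ℝ) : ℂ)) (fun _ => 0))

/-- `ψ_u = √(σ_u / (C₁ R)) |u⟩ + ∑ √w_uv |uv⟩`, without the first term if `u` is not in the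
support of `σ`. -/
def psi (X : Network V) (C₁ R : ℝ) (u : V) : X.Space :=
  WithLp.toLp 2 (Sum.elim
    (fun s => if (s : V) = u then ((√(X.σ u / (C₁ * R)) : ℝ) : ℂ) else 0)
    (fun e => if u ∈ (e : Sym2 V) then ((√(X.w e) : ℝ) : ℂ) else 0))

/-- The diffusion `D_u` when the marked set is `M`, extended by the identity from the local space
of `u` (the span of `|u⟩` and of the edges at `u`) to the whole space. As `ψ_u` is in the local
space, for a non-marked `u` this is the reflection about the orthogonal complement of `ψ_u`. -/
def diffusion (X : Network V) (C₁ R : ℝ) (M : Finset V) (u : V) : X.Space →ₗ[ℂ] X.Space :=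
  if u ∈ M then LinearMap.id
  else ((ℂ ∙ X.psi C₁ R u)ᗮ.reflection.toLinearEquiv : X.Space →ₗ[ℂ] X.Space)

/-- The direct sum of the diffusions `D_u` over the vertices `u` of one part `P` of the
bipartition, acting as the identity on the orthogonal complement of the local spaces. (The local
spaces are pairwise orthogonal, and each `D_u - 1` vanishes off the local space of `u`.) -/
def reflectionSum (X : Network V) (C₁ R : ℝ) (M P : Finset V) : X.Space →ₗ[ℂ] X.Space :=
  LinearMap.id + ∑ u ∈ P, (X.diffusion C₁ R M u - LinearMap.id)

/-- The step `R_B R_A` of the quantum walk. -/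
def step (X : Network V) (C₁ R : ℝ) (M : Finset V) : X.Space →ₗ[ℂ] X.Space :=
  X.reflectionSum C₁ R M X.B ∘ₗ X.reflectionSum C₁ R M X.A

/-- The component of the initial state on the vertices `u` of the support of `σ` whose mark bit is `b`: the unnormalized
state after the measurement of that bit with the result `b`. Its squared norm is the probability
of this result. -/
def afterMark (X : Network V) (M : Finset V) (b : Bool) : X.Space :=
  WithLp.toLp 2 (Sum.elim
    (fun u => if decide ((u : V) ∈ M) = b then X.initial (Sum.inl u) else 0) (fun _ => 0))

end Network

/-! ### Circuits with a black-box operator, and phase estimation -/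

/-- The gates of a circuit on a `T`-dimensional register and a target system on which a black-box
operator acts. -/
inductive Gate (T : ℕ) : Type
  /-- a unitary on the register -/
  | register (F : Matrix.unitaryGroup (Fin T) ℂ) : Gate T
  /-- one application of the black box, controlled by the register being in a state of `s` -/
  | controlled (s : Finset (Fin T)) : Gate T

/-- Whether a gate uses the black box. -/
def Gate.isControlled {T : ℕ} : Gate T → Bool
  | .register _ => false
  | .controlled _ => true

section circuits

variable {H : Type*} [NormedAddCommGroup H] [InnerProductSpace ℂ H]

/-- The action of a gate; the joint state `∑ |k⟩ ⊗ Ψ k` is represented by `Ψ`. -/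
def Gate.apply {T : ℕ} (U : H →ₗ[ℂ] H) : Gate T → (Fin T → H) → (Fin T → H)
  | .register F, Ψ => fun k => ∑ j, (F : Matrix (Fin T) (Fin T) ℂ) k j • Ψ j
  | .controlled s, Ψ => fun k => if k ∈ s then U (Ψ k) else Ψ k

/-- Run a circuit, its first gate first, on the register state `|0⟩` and the target state `x`. -/
def runCircuit {T : ℕ} (U : H →ₗ[ℂ] H) (c : List (Gate T)) (x : H) : Fin T → H :=
  c.foldl (fun Ψ g => g.apply U Ψ) (fun k => if (k : ℕ) = 0 then x else 0)

/-- The number of controlled applications of the black box in a circuit. -/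
def steps {T : ℕ} (c : List (Gate T)) : ℕ := c.countP Gate.isControlled

end circuits

/-- The matrix of the quantum Fourier transform over `ℤ/T`. -/
def qftMatrix (T : ℕ) : Matrix (Fin T) (Fin T) ℂ :=
  fun j k => ((1 / √(T : ℝ) : ℝ) : ℂ) *
    Complex.exp (2 * Real.pi * Complex.I * ((j : ℕ) : ℂ) * ((k : ℕ) : ℂ) / (T : ℂ))

theorem qftMatrix_mem (T : ℕ) : qftMatrix T ∈ Matrix.unitaryGroup (Fin T) ℂ := by
  rw [Matrix.mem_unitaryGroup_iff]
  ext j l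
  have hT : 0 < T := lt_of_le_of_lt (Nat.zero_le _) j.2
  have hT' : (T : ℂ) ≠ 0 := by exact_mod_cast hT.ne'
  have hr : ((1 / √(T : ℝ) : ℝ) : ℂ) * ((1 / √(T : ℝ) : ℝ) : ℂ) = 1 / (T : ℂ) := by
    rw [← Complex.ofReal_mul, div_mul_div_comm, Real.mul_self_sqrt (Nat.cast_nonneg T)]
    simp
  set x : ℂ := Complex.exp (2 * Real.pi * Complex.I * (((j : ℕ) : ℂ) - ((l : ℕ) : ℂ)) / (T : ℂ))
    with hx
  have hterm : ∀ k : Fin T, qftMatrix T j k * star (qftMatrix T l k) = 1 / (T : ℂ) * x ^ (k : ℕ) := by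
    intro k
    have h1 : star (qftMatrix T l k) = ((1 / √(T : ℝ) : ℝ) : ℂ) *
        Complex.exp (-(2 * Real.pi * Complex.I * ((l : ℕ) : ℂ) * ((k : ℕ) : ℂ) / (T : ℂ))) := by
      rw [qftMatrix, Complex.star_def, map_mul, Complex.conj_ofReal, ← Complex.exp_conj]
      congr 2
      simp only [map_div₀, map_mul, Complex.conj_I, Complex.conj_ofReal, map_natCast, map_ofNat]
      ring
    rw [h1, qftMatrix, mul_mul_mul_comm, hr, ← Complex.exp_add, hx, ← Complex.exp_nat_mul]
    congr 2
    ring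
  rw [Matrix.mul_apply]
  simp only [Matrix.star_apply]
  rw [Finset.sum_congr rfl (fun k _ => hterm k), ← Finset.mul_sum,
    Fin.sum_univ_eq_sum_range (fun k => x ^ k) T]
  by_cases hjl : j = l
  · subst hjl
    simp [hx, hT']
  · rw [Matrix.one_apply_ne hjl]
    have hxT : x ^ T = 1 := by
      rw [hx, ← Complex.exp_nat_mul, Complex.exp_eq_one_iff]
      refine ⟨(j : ℤ) - (l : ℤ), ?_⟩
      push_cast
      field_simp
    have hx1 : x ≠ 1 := by
      intro h
      rw [hx, Complex.exp_eq_one_iff] at h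
      obtain ⟨n, hn⟩ := h
      have hp : (2 * Real.pi * Complex.I : ℂ) ≠ 0 := Complex.two_pi_I_ne_zero
      have h2 : (((j : ℕ) : ℂ) - ((l : ℕ) : ℂ)) = n * T := by
        rw [div_eq_iff hT'] at hn
        apply mul_left_cancel₀ hp
        rw [hn]
        ring
      have h3 : ((j : ℕ) : ℤ) - ((l : ℕ) : ℤ) = n * T := by exact_mod_cast h2
      have hj := j.2
      have hl := l.2
      have h4 : n = 0 := by
        by_contra hn0
        rcases lt_or_gt_of_ne hn0 with h | h <;> nlinarith
      rw [h4] at h3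
      exact hjl (Fin.ext (by omega))
    have := mul_geom_sum x T
    rw [hxT, sub_self] at this
    rcases mul_eq_zero.1 this with h | h
    · exact absurd (sub_eq_zero.1 h) hx1
    · rw [h, mul_zero]

/-- The quantum Fourier transform over `ℤ/T`. -/
def qft (T : ℕ) : Matrix.unitaryGroup (Fin T) ℂ := ⟨qftMatrix T, qftMatrix_mem T⟩

/-- Quantum phase estimation with a `T`-dimensional register: make the register uniform, apply
`|k⟩ ⊗ x ↦ |k⟩ ⊗ U ^ k x` by `T - 1` controlled applications of `U` (the `i`-th of them acts if
`i < k`), and apply the inverse Fourier transform to the register. -/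
def phaseEstimation (T : ℕ) : List (Gate T) :=
  [Gate.register (qft T)] ++
  (List.range (T - 1)).map (fun i => Gate.controlled (Finset.univ.filter fun k => i < (k : ℕ))) ++
  [Gate.register (qft T)⁻¹]

/-- The phase in `(-π, π]` which is reported when the register is measured to be `k`. -/
def reportedPhase {T : ℕ} (k : Fin T) : ℝ :=
  Real.Angle.toReal ((2 * Real.pi * (k : ℕ) / T : ℝ) : Real.Angle)

/-- The size of the register for precision `δ`. With this size, for an eigenvector with
eigenvalue `exp (i φ)`, the reported phase is within `δ` of `φ` (modulo `2 π`) with probability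
at least `9 / 10`. -/
def registerSize (δ : ℝ) : ℕ := ⌈16 * Real.pi / δ⌉₊

/-! ### The algorithm -/

namespace Network

/-- The precision `1 / (C √(R W))` of the phase estimation. -/
def precision (X : Network V) (C R : ℝ) : ℝ := 1 / (C * √(R * X.totalWeight))

/-- The phase estimation circuit of the algorithm. -/
def circuit (X : Network V) (C R : ℝ) : List (Gate (registerSize (X.precision C R))) :=
  phaseEstimation (registerSize (X.precision C R))

/-- The number of steps of the quantum walk used by the algorithm. -/
def walkSteps (X : Network V) (C R : ℝ) : ℕ := steps (X.circuit C R)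

/-- The joint probability that the mark bit is measured to be `0` and the phase estimation on the
walk step then yields `k`. -/
def outcomeProb (X : Network V) (C₁ C R : ℝ) (M : Finset V)
    (k : Fin (registerSize (X.precision C R))) : ℝ :=
  ‖runCircuit (X.step C₁ R M) (X.circuit C R) (X.afterMark M false) k‖ ^ 2

/-- The probability of the output "marked vertices exist": either the mark bit is `1`, or it is
`0` and the eigenvalue is estimated to be `1`, that is, the reported phase is `0` up to the
precision. -/
def probYes (X : Network V) (C₁ C R : ℝ) (M : Finset V) : ℝ :=
  ‖X.afterMark M true‖ ^ 2 +
    ∑ k with |reportedPhase k| ≤ X.precision C R, X.outcomeProb C₁ C R M k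

/-- The probability of the output "no marked vertices". -/
def probNo (X : Network V) (C₁ C R : ℝ) (M : Finset V) : ℝ :=
  ∑ k with ¬ |reportedPhase k| ≤ X.precision C R, X.outcomeProb C₁ C R M k

end Network

end QuantumWalk

end

/-!
Both halves of the correctness proof reduce to a single vector, and no spectral decomposition of the
step `U = R_B R_A` is needed: the amplitude of the outcome `k` of phase estimation on `x` is the
Fourier average `T⁻¹ ∑_{j < T} z ^ j U ^ j x` with `z = exp (-2 π i k / T)`
(`runCircuit_phaseEstimation`), and it is estimated directly.

*Marked vertices.* A flow `p` of energy at most `2 R` from `σ` to `M` gives the vector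
`φ = √(C₁ R) ∑_{u ∉ M} √σ_u |u⟩ - ∑ p_e / √w_e |e⟩`. Conservation of the flow at `u` says that
`φ ⊥ ψ_u`, so `U φ = φ` (`Flow.step_vector`). The average of a state over its orbit keeps its overlap
with `φ`, so the outcome `0` has at least the weight of the normalized overlap
(`norm_inner_le_phaseEstimation_zero`), and this is close to the unmarked mass if `C₁` is large.

*No marked vertex.* Put `y = ∑_{u ∈ A} ψ_u`. Then `R_A y = -y`, while `y` is `∑_{u ∈ B} ψ_u`, which
`R_B` negates, plus the initial state divided by `√(C₁ R)`, which `R_B` fixes. Hence the initial state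
is `(√(C₁ R) / 2) (y - U y)` (`initial_eq_sub_step`). Summation by parts in the Fourier average
replaces `1 - U` by a factor of size at most the reported phase, up to a boundary term of order `1 / T`
(`norm_phaseEstimation_sub_le`), so the total weight of the `O(1)` outcomes with phase at most `δ` is
`O(δ ^ 2 (1 + C₁ R W))` (`sum_phaseEstimation_sub_le`). By Cauchy–Schwarz, `R W` is bounded below
when a flow of energy at most `2 R` carries a constant mass (`Flow.sq_norm_afterMark_le`), so this
weight is small if `C` is large. The same bound shows that the register is not empty in the cases
where phase estimation matters.
-/

noncomputable section

namespace QuantumWalk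

open scoped Classical ENNReal

/-! ### Phase estimation -/

section circuits

variable {H : Type*} [NormedAddCommGroup H] [InnerProductSpace ℂ H]

theorem Gate.apply_register {T : ℕ} (U : H →ₗ[ℂ] H) (F : Matrix.unitaryGroup (Fin T) ℂ)
    (Ψ : Fin T → H) (k : Fin T) :
    (Gate.register F).apply U Ψ k = ∑ j, (F : Matrix (Fin T) (Fin T) ℂ) k j • Ψ j :=
  rfl

theorem Gate.apply_controlled {T : ℕ} (U : H →ₗ[ℂ] H) (s : Finset (Fin T))
    (Ψ : Fin T → H) (k : Fin T) :
    (Gate.controlled s).apply U Ψ k = if k ∈ s then U (Ψ k) else Ψ k :=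
  rfl

theorem sum_norm_sq_unitary {ι : Type*} [Fintype ι] [DecidableEq ι] {F : Matrix ι ι ℂ}
    (hF : F ∈ Matrix.unitaryGroup ι ℂ) (Ψ : ι → H) :
    ∑ k, ‖∑ j, F k j • Ψ j‖ ^ 2 = ∑ k, ‖Ψ k‖ ^ 2 := by
  have hF' : ∀ j l, ∑ k, (starRingEnd ℂ) (F k j) * F k l = if j = l then 1 else 0 := by
    intro j l
    have h := congrFun (congrFun (Matrix.mem_unitaryGroup_iff'.1 hF) j) l
    simpa [Matrix.mul_apply, Matrix.one_apply, Matrix.star_apply] using h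
  have key : ∑ k, inner ℂ (∑ j, F k j • Ψ j) (∑ j, F k j • Ψ j) = ∑ k, inner ℂ (Ψ k) (Ψ k) := by
    calc ∑ k, inner ℂ (∑ j, F k j • Ψ j) (∑ j, F k j • Ψ j)
        = ∑ k, ∑ j, ∑ l, ((starRingEnd ℂ) (F k j) * F k l) * inner ℂ (Ψ j) (Ψ l) := by
          simp only [sum_inner, inner_sum, inner_smul_left, inner_smul_right, Finset.mul_sum]
          refine Finset.sum_congr rfl fun k _ => Finset.sum_comm.trans ?_
          refine Finset.sum_congr rfl fun j _ => Finset.sum_congr rfl fun l _ => ?_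
          ring
      _ = ∑ j, ∑ l, (∑ k, (starRingEnd ℂ) (F k j) * F k l) * inner ℂ (Ψ j) (Ψ l) := by
          rw [Finset.sum_comm]
          refine Finset.sum_congr rfl fun j _ => ?_
          rw [Finset.sum_comm]
          simp only [Finset.sum_mul]
      _ = ∑ k, inner ℂ (Ψ k) (Ψ k) := by simp [hF']
  simp only [inner_self_eq_norm_sq_to_K] at key
  exact_mod_cast key

theorem sum_norm_sq_runCircuit {T : ℕ} [NeZero T] {U : H →ₗ[ℂ] H} (hU : ∀ x, ‖U x‖ = ‖x‖)
    (c : List (Gate T)) (x : H) : ∑ k, ‖runCircuit U c x k‖ ^ 2 = ‖x‖ ^ 2 := by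
  have hg : ∀ (g : Gate T) (Ψ : Fin T → H), ∑ k, ‖g.apply U Ψ k‖ ^ 2 = ∑ k, ‖Ψ k‖ ^ 2 := by
    rintro (F | s) Ψ
    · simp only [Gate.apply_register]
      exact sum_norm_sq_unitary F.2 Ψ
    · refine Finset.sum_congr rfl fun k _ => ?_
      rw [Gate.apply_controlled]
      split_ifs
      · rw [hU]
      · rfl
  have hc : ∀ (c : List (Gate T)) (Ψ : Fin T → H),
      ∑ k, ‖c.foldl (fun Ψ g => g.apply U Ψ) Ψ k‖ ^ 2 = ∑ k, ‖Ψ k‖ ^ 2 := by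
    intro c
    induction c with
    | nil => intro Ψ; rfl
    | cons g c ih => intro Ψ; rw [List.foldl_cons, ih, hg]
  rw [runCircuit, hc, Finset.sum_eq_single (0 : Fin T)]
  · simp
  · intro k _ hk
    have : (k : ℕ) ≠ 0 := fun h => hk (Fin.ext (by simpa using h))
    simp [this]
  · simp

/-- The ramp of controlled gates of phase estimation applies `U ^ k` to the branch of the
register state `k`. -/
theorem foldl_controlled {T : ℕ} (U : H →ₗ[ℂ] H) (Ψ : Fin T → H) (n : ℕ) (k : Fin T) :
    ((List.range n).map fun i =>
        (Gate.controlled (Finset.univ.filter fun k : Fin T => i < (k : ℕ)) : Gate T)).foldl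
      (fun Ψ g => g.apply U Ψ) Ψ k = (U ^ min (k : ℕ) n) (Ψ k) := by
  induction n with
  | zero => simp
  | succ n ih =>
    rw [List.range_succ, List.map_append, List.foldl_append]
    simp only [List.map_cons, List.map_nil, List.foldl_cons, List.foldl_nil,
      Gate.apply_controlled, Finset.mem_filter, Finset.mem_univ, true_and, ih]
    split_ifs with h
    · rw [min_eq_right h.le, min_eq_right (Nat.succ_le_of_lt h), pow_succ', Module.End.mul_apply]
    · rw [min_eq_left (not_lt.1 h), min_eq_left (by omega)]

/-- The amplitude of the outcome `k` of phase estimation is the Fourier average of the orbit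
`U ^ j x`. -/
theorem runCircuit_phaseEstimation {T : ℕ} [NeZero T] (U : H →ₗ[ℂ] H) (x : H) (k : Fin T) :
    runCircuit U (phaseEstimation T) x k = (1 / (T : ℂ)) • ∑ j ∈ Finset.range T,
      Complex.exp (-((2 * Real.pi * (k : ℕ) / T : ℝ) * Complex.I)) ^ j • (U ^ j) x := by
  have hT : (T : ℂ) ≠ 0 := Nat.cast_ne_zero.2 (NeZero.ne T)
  have h1 : ∀ j : Fin T, (Gate.register (qft T)).apply U (fun k => if (k : ℕ) = 0 then x else 0) j
      = ((1 / √(T : ℝ) : ℝ) : ℂ) • x := by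
    intro j
    rw [Gate.apply_register]
    rw [Finset.sum_eq_single (0 : Fin T)]
    · simp [qft, qftMatrix]
    · intro k _ hk
      have : (k : ℕ) ≠ 0 := fun h => hk (Fin.ext (by simpa using h))
      simp [this]
    · simp
  have hr : ((1 / √(T : ℝ) : ℝ) : ℂ) * ((1 / √(T : ℝ) : ℝ) : ℂ) = 1 / (T : ℂ) := by
    rw [← Complex.ofReal_mul, div_mul_div_comm, Real.mul_self_sqrt (Nat.cast_nonneg T)]
    simp
  rw [runCircuit, phaseEstimation, List.foldl_append, List.foldl_append]
  simp only [List.foldl_cons, List.foldl_nil]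
  rw [Gate.apply_register]
  simp only [foldl_controlled, h1]
  rw [← Fin.sum_univ_eq_sum_range (fun j =>
    Complex.exp (-((2 * Real.pi * (k : ℕ) / T : ℝ) * Complex.I)) ^ j • (U ^ j) x) T,
    Finset.smul_sum]
  refine Finset.sum_congr rfl fun j _ => ?_
  have hj : min (j : ℕ) (T - 1) = j := min_eq_left (by have := j.2; omega)
  have hF : (((qft T)⁻¹ : Matrix.unitaryGroup (Fin T) ℂ) : Matrix (Fin T) (Fin T) ℂ) k j
      = ((1 / √(T : ℝ) : ℝ) : ℂ) *
        Complex.exp (-((2 * Real.pi * (k : ℕ) / T : ℝ) * Complex.I)) ^ (j : ℕ) := by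
    rw [Matrix.UnitaryGroup.inv_apply, Matrix.star_apply]
    simp only [qft, qftMatrix]
    rw [Complex.star_def, map_mul, Complex.conj_ofReal, ← Complex.exp_conj, ← Complex.exp_nat_mul]
    congr 2
    simp only [map_div₀, map_mul, Complex.conj_I, Complex.conj_ofReal, map_natCast, map_ofNat]
    push_cast
    ring
  rw [hj, hF, map_smul, smul_smul, smul_smul, ← hr]
  congr 1
  ring

/-- A state that overlaps a fixed vector of `U` yields the outcome `0` with at least the weight of
this overlap. -/
theorem norm_inner_le_phaseEstimation_zero {T : ℕ} [NeZero T] {U : H →ₗ[ℂ] H}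
    (hU : ∀ x, ‖U x‖ = ‖x‖) {φ : H} (hφ : U φ = φ) (x : H) :
    ‖inner ℂ φ x‖ ≤ ‖φ‖ * ‖runCircuit U (phaseEstimation T) x 0‖ := by
  have hT : (T : ℂ) ≠ 0 := Nat.cast_ne_zero.2 (NeZero.ne T)
  have hinner : ∀ y, inner ℂ φ (U y) = inner ℂ φ y := by
    intro y
    have := (LinearIsometry.mk U hU).inner_map_map φ y
    simpa [hφ] using this
  have hpow : ∀ j : ℕ, inner ℂ φ ((U ^ j) x) = inner ℂ φ x := by
    intro j
    induction j with
    | zero => simp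
    | succ j ih => rw [pow_succ', Module.End.mul_apply, hinner, ih]
  have h : inner ℂ φ (runCircuit U (phaseEstimation T) x 0) = inner ℂ φ x := by
    rw [runCircuit_phaseEstimation]
    simp [hpow, hT]
  rw [← h]
  exact norm_inner_le_norm _ _

/-- If `x = y - U y`, summation by parts shows that the amplitude of the outcome `k` on `x` is that
on `y` times the distance of the reported phase factor from `1`, up to a boundary term. -/
theorem norm_phaseEstimation_sub_le {T : ℕ} [NeZero T] {U : H →ₗ[ℂ] H}
    (hU : ∀ x, ‖U x‖ = ‖x‖) (y : H) (k : Fin T) :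
    ‖runCircuit U (phaseEstimation T) (y - U y) k‖ ≤
      |reportedPhase k| * ‖runCircuit U (phaseEstimation T) y k‖ + 2 * ‖y‖ / T := by
  have hT : (T : ℂ) ≠ 0 := Nat.cast_ne_zero.2 (NeZero.ne T)
  set θ : ℝ := 2 * Real.pi * (k : ℕ) / T with hθ
  set z : ℂ := Complex.exp (-((θ : ℝ) * Complex.I)) with hz
  have hz0 : z ≠ 0 := Complex.exp_ne_zero _
  have hzT : z ^ T = 1 := by
    rw [hz, ← Complex.exp_nat_mul, Complex.exp_eq_one_iff]
    refine ⟨-((k : ℕ) : ℤ), ?_⟩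
    rw [hθ]
    push_cast
    field_simp
  have hzinv : z⁻¹ = Complex.exp ((reportedPhase k : ℝ) * Complex.I) := by
    rw [hz, ← Complex.exp_neg, neg_neg]
    have h : ((θ : ℝ) : Real.Angle) = ((reportedPhase k : ℝ) : Real.Angle) := by
      rw [reportedPhase, Real.Angle.coe_toReal]
    obtain ⟨n, hn⟩ := Real.Angle.angle_eq_iff_two_pi_dvd_sub.1 h
    rw [Complex.exp_eq_exp_iff_exists_int]
    refine ⟨n, ?_⟩
    have : θ = reportedPhase k + 2 * Real.pi * n := by linarith
    rw [this]
    push_cast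
    ring
  have hzn : ‖z‖ = 1 := by
    rw [hz, ← neg_mul, ← Complex.ofReal_neg, Complex.norm_exp_ofReal_mul_I]
  have hUn : ∀ n : ℕ, ‖(U ^ n) y‖ = ‖y‖ := by
    intro n
    induction n with
    | zero => simp
    | succ n ih => rw [pow_succ', Module.End.mul_apply, hU, ih]
  have htel : ∀ n : ℕ, ∑ j ∈ Finset.range n, z ^ j • (U ^ j) (y - U y)
      = (1 - z⁻¹) • ∑ j ∈ Finset.range n, z ^ j • (U ^ j) y
        + z⁻¹ • (y - z ^ n • (U ^ n) y) := by
    intro n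
    induction n with
    | zero => simp
    | succ n ih =>
      have h2 : (U ^ n) (U y) = (U ^ (n + 1)) y := by
        rw [pow_succ, Module.End.mul_apply]
      rw [Finset.sum_range_succ, Finset.sum_range_succ, ih, map_sub, h2, pow_succ]
      match_scalars <;> field_simp <;> ring
  have hform : runCircuit U (phaseEstimation T) (y - U y) k
      = (1 - z⁻¹) • runCircuit U (phaseEstimation T) y k
        + ((1 / (T : ℂ)) * z⁻¹) • (y - (U ^ T) y) := by
    rw [runCircuit_phaseEstimation, runCircuit_phaseEstimation, htel, hzT, one_smul]
    match_scalars <;> ring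
  rw [hform]
  refine (norm_add_le _ _).trans (add_le_add ?_ ?_)
  · rw [norm_smul]
    refine mul_le_mul_of_nonneg_right ?_ (norm_nonneg _)
    rw [hzinv, norm_sub_rev, mul_comm]
    simpa using Real.norm_exp_I_mul_ofReal_sub_one_le (x := reportedPhase k)
  · rw [norm_smul, norm_mul, norm_inv, hzn, norm_div, norm_one, Complex.norm_natCast, inv_one,
      mul_one, div_mul_eq_mul_div, one_mul]
    refine div_le_div_of_nonneg_right ?_ (Nat.cast_nonneg _)
    calc ‖y - (U ^ T) y‖ ≤ ‖y‖ + ‖(U ^ T) y‖ := norm_sub_le _ _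
      _ = 2 * ‖y‖ := by rw [hUn]; ring

end circuits

/-- At most `2 n` outcomes of phase estimation report a phase in the window of radius `δ`, when this
window has radius less than `n` grid points. -/
theorem card_reportedPhase_le {T : ℕ} {δ : ℝ} {n : ℕ} (hn : δ * T < 2 * Real.pi * n)
    (hnT : n ≤ T) : (Finset.univ.filter fun k : Fin T => |reportedPhase k| ≤ δ).card ≤ 2 * n := by
  rcases Nat.eq_zero_or_pos T with rfl | hT
  · simp
  have hT' : (0 : ℝ) < T := by exact_mod_cast hT
  have hsub : (Finset.univ.filter fun k : Fin T => |reportedPhase k| ≤ δ).map Fin.valEmbedding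
      ⊆ Finset.range n ∪ Finset.Ico (T - n) T := by
    intro a ha
    obtain ⟨k, hk, rfl⟩ := Finset.mem_map.1 ha
    simp only [Finset.mem_filter, Finset.mem_univ, true_and] at hk
    simp only [Fin.valEmbedding_apply, Finset.mem_union, Finset.mem_range, Finset.mem_Ico]
    have h : ((reportedPhase k : ℝ) : Real.Angle) = ((2 * Real.pi * (k : ℕ) / T : ℝ) : Real.Angle) := by
      rw [reportedPhase, Real.Angle.coe_toReal]
    obtain ⟨m, hm⟩ := Real.Angle.angle_eq_iff_two_pi_dvd_sub.1 h
    have h1 : reportedPhase k * T = 2 * Real.pi * ((k : ℕ) + m * T) := by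
      have : reportedPhase k = 2 * Real.pi * (k : ℕ) / T + 2 * Real.pi * m := by linarith
      rw [this]
      field_simp
    have h2 : 2 * Real.pi * |((k : ℕ) : ℝ) + m * T| < 2 * Real.pi * n := by
      rw [← abs_of_pos Real.two_pi_pos, ← abs_mul, abs_of_pos Real.two_pi_pos, ← h1, abs_mul,
        abs_of_pos hT']
      exact (mul_le_mul_of_nonneg_right hk hT'.le).trans_lt hn
    have h3 := lt_of_mul_lt_mul_left h2 Real.two_pi_pos.le
    have h4 : |((k : ℕ) : ℤ) + m * T| < n := by exact_mod_cast h3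
    obtain ⟨h5, h6⟩ := abs_lt.1 h4
    have hk2 := k.2
    have hm1 : m < 1 := by
      by_contra hc
      nlinarith [not_lt.1 hc]
    have hm2 : -2 < m := by
      by_contra hc
      nlinarith [not_lt.1 hc]
    obtain rfl | rfl : m = 0 ∨ m = -1 := by omega
    · left; omega
    · right; omega
  have := Finset.card_le_card hsub
  rw [Finset.card_map] at this
  refine this.trans ((Finset.card_union_le _ _).trans ?_)
  rw [Finset.card_range, Nat.card_Ico]
  omega

theorem steps_phaseEstimation (T : ℕ) : steps (phaseEstimation T) = T - 1 := by
  have h : ∀ n : ℕ, ((List.range n).map fun i =>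
      (Gate.controlled (Finset.univ.filter fun k : Fin T => i < (k : ℕ)) : Gate T)).countP
        Gate.isControlled = n := by
    intro n
    rw [List.countP_eq_length.2]
    · simp
    · intro g hg
      obtain ⟨i, -, rfl⟩ := List.mem_map.1 hg
      rfl
  rw [steps, phaseEstimation, List.countP_append, List.countP_append, h]
  simp [Gate.isControlled]

/-! ### The bipartition -/

namespace Network

variable {V : Type*} [Fintype V] (X : Network V)

theorem disjoint_parts : Disjoint X.A X.B := by
  exact_mod_cast X.bipartite.disjoint

theorem not_adj_of_mem_A {u v : V} (hu : u ∈ X.A) (hv : v ∈ X.A) : ¬ X.graph.Adj u v := by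
  intro h
  rcases X.bipartite.mem_of_adj h with h | h
  · exact Finset.disjoint_left.1 X.disjoint_parts hv (by exact_mod_cast h.2)
  · exact Finset.disjoint_left.1 X.disjoint_parts hu (by exact_mod_cast h.1)

theorem not_adj_of_mem_B {u v : V} (hu : u ∈ X.B) (hv : v ∈ X.B) : ¬ X.graph.Adj u v := by
  intro h
  rcases X.bipartite.mem_of_adj h with h | h
  · exact Finset.disjoint_left.1 X.disjoint_parts (by exact_mod_cast h.1) hu
  · exact Finset.disjoint_left.1 X.disjoint_parts (by exact_mod_cast h.2) hv

theorem exists_edge_ends (e : X.graph.edgeSet) :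
    ∃ a b, (e : Sym2 V) = s(a, b) ∧ a ∈ X.A ∧ a ∉ X.B ∧ b ∈ X.B ∧ b ∉ X.A := by
  obtain ⟨e, he⟩ := e
  induction e using Sym2.ind with
  | _ u v =>
    have hd := X.disjoint_parts
    rcases X.bipartite.mem_of_adj (SimpleGraph.mem_edgeSet _ |>.1 he) with h | h
    · have h1 : u ∈ X.A := by exact_mod_cast h.1
      have h2 : v ∈ X.B := by exact_mod_cast h.2
      exact ⟨u, v, rfl, h1, Finset.disjoint_left.1 hd h1, h2, Finset.disjoint_right.1 hd h2⟩
    · have h1 : u ∈ X.B := by exact_mod_cast h.1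
      have h2 : v ∈ X.A := by exact_mod_cast h.2
      exact ⟨v, u, Sym2.eq_swap, h2, Finset.disjoint_left.1 hd h2, h1,
        Finset.disjoint_right.1 hd h1⟩

theorem sum_edgeSet (g : Sym2 V → ℝ) :
    ∑ e : X.graph.edgeSet, g e = ∑ e ∈ X.graph.edgeFinset, g e :=
  (Finset.sum_subtype _ (fun _ => SimpleGraph.mem_edgeFinset) g).symm

theorem sum_supp {g : V → ℝ} (hg : ∀ u, X.σ u = 0 → g u = 0) :
    ∑ s : {u : V // X.σ u ≠ 0}, g s = ∑ u, g u := by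
  rw [← Finset.sum_subtype (Finset.univ.filter fun u => X.σ u ≠ 0) (fun u => by simp) g]
  refine Finset.sum_subset (Finset.filter_subset _ _) fun u _ hu => hg u ?_
  simpa using hu

/-! ### The reflections of the walk -/

theorem inner_psi_eq_zero (C₁ R : ℝ) {u v : V} (huv : u ≠ v) (hadj : ¬ X.graph.Adj u v) :
    inner ℂ (X.psi C₁ R u) (X.psi C₁ R v) = 0 := by
  rw [PiLp.inner_apply]
  refine Finset.sum_eq_zero fun i _ => ?_
  rcases i with s | e
  · simp only [psi, Sum.elim_inl]
    by_cases h : (s : V) = u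
    · have : (s : V) ≠ v := fun h' => huv (h.symm.trans h')
      simp [this]
    · simp [h]
  · simp only [psi, Sum.elim_inr]
    by_cases h : u ∈ (e : Sym2 V)
    · have : v ∉ (e : Sym2 V) := by
        intro h'
        have he := (Sym2.mem_and_mem_iff huv).1 ⟨h, h'⟩
        exact hadj ((SimpleGraph.mem_edgeSet _).1 (he ▸ e.2))
      simp [this]
    · simp [h]

theorem norm_diffusion (C₁ R : ℝ) (M : Finset V) (u : V) (x : X.Space) :
    ‖X.diffusion C₁ R M u x‖ = ‖x‖ := by
  rw [diffusion]
  split_ifs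
  · rfl
  · exact ((ℂ ∙ X.psi C₁ R u)ᗮ.reflection).norm_map x

theorem diffusion_of_inner_eq_zero (C₁ R : ℝ) {M : Finset V} {u : V} {x : X.Space}
    (hx : u ∉ M → inner ℂ (X.psi C₁ R u) x = 0) : X.diffusion C₁ R M u x = x := by
  rw [diffusion]
  split_ifs with h
  · rfl
  · exact Submodule.reflection_mem_subspace_eq_self
      (Submodule.mem_orthogonal_singleton_iff_inner_right.2 (hx h))

theorem diffusion_psi (C₁ R : ℝ) {M : Finset V} {u : V} (hu : u ∉ M) :
    X.diffusion C₁ R M u (X.psi C₁ R u) = -X.psi C₁ R u := by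
  rw [diffusion, if_neg hu]
  exact Submodule.reflection_orthogonalComplement_singleton_eq_neg _

theorem diffusion_sub_mem (C₁ R : ℝ) (M : Finset V) (u : V) (x : X.Space) :
    X.diffusion C₁ R M u x - x ∈ ℂ ∙ X.psi C₁ R u := by
  rw [diffusion]
  split_ifs
  · simp
  · have h : (ℂ ∙ X.psi C₁ R u)ᗮ.reflection x - x
        = (-2 : ℂ) • (ℂ ∙ X.psi C₁ R u).starProjection x := by
      rw [Submodule.reflection_orthogonal_apply, Submodule.reflection_apply]
      module
    change (ℂ ∙ X.psi C₁ R u)ᗮ.reflection x - x ∈ _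
    rw [h]
    exact Submodule.smul_mem _ _ (Submodule.starProjection_apply_mem _ _)

theorem reflectionSum_apply (C₁ R : ℝ) (M P : Finset V) (x : X.Space) :
    X.reflectionSum C₁ R M P x = x + ∑ u ∈ P, (X.diffusion C₁ R M u x - x) := by
  simp [reflectionSum, LinearMap.sum_apply]

/-- Over an independent set of vertices the sum of the diffusions is also their product, hence an
isometry. -/
theorem norm_reflectionSum (C₁ R : ℝ) (M : Finset V) {P : Finset V}
    (hP : ∀ u ∈ P, ∀ v ∈ P, ¬ X.graph.Adj u v) (x : X.Space) :
    ‖X.reflectionSum C₁ R M P x‖ = ‖x‖ := by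
  induction P using Finset.induction_on with
  | empty => simp [reflectionSum_apply]
  | insert u P hu ih =>
    have ih' := ih fun a ha b hb =>
      hP a (Finset.mem_insert_of_mem ha) b (Finset.mem_insert_of_mem hb)
    have hfix : ∀ v ∈ P, X.diffusion C₁ R M u (X.diffusion C₁ R M v x - x)
        = X.diffusion C₁ R M v x - x := by
      intro v hv
      refine X.diffusion_of_inner_eq_zero C₁ R fun _ => ?_
      obtain ⟨c, hc⟩ := Submodule.mem_span_singleton.1 (X.diffusion_sub_mem C₁ R M v x)
      rw [← hc, inner_smul_right, X.inner_psi_eq_zero C₁ R, mul_zero]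
      · rintro rfl
        exact hu hv
      · exact hP u (Finset.mem_insert_self _ _) v (Finset.mem_insert_of_mem hv)
    have h : X.reflectionSum C₁ R M (insert u P) x
        = X.diffusion C₁ R M u (X.reflectionSum C₁ R M P x) := by
      rw [reflectionSum_apply, reflectionSum_apply, Finset.sum_insert hu, map_add, map_sum,
        Finset.sum_congr rfl hfix]
      abel
    rw [h, norm_diffusion, ih']

theorem norm_step (C₁ R : ℝ) (M : Finset V) (x : X.Space) : ‖X.step C₁ R M x‖ = ‖x‖ := by
  rw [step, LinearMap.comp_apply,
    X.norm_reflectionSum C₁ R M fun _ hu _ hv => X.not_adj_of_mem_B hu hv,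
    X.norm_reflectionSum C₁ R M fun _ hu _ hv => X.not_adj_of_mem_A hu hv]

theorem reflectionSum_of_inner_eq_zero (C₁ R : ℝ) {M P : Finset V} {x : X.Space}
    (hx : ∀ u ∈ P, u ∉ M → inner ℂ (X.psi C₁ R u) x = 0) : X.reflectionSum C₁ R M P x = x := by
  rw [reflectionSum_apply, Finset.sum_eq_zero fun u hu => ?_, add_zero]
  rw [X.diffusion_of_inner_eq_zero C₁ R (hx u hu), sub_self]

theorem reflectionSum_sum_psi (C₁ R : ℝ) {P : Finset V}
    (hP : ∀ u ∈ P, ∀ v ∈ P, ¬ X.graph.Adj u v) :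
    X.reflectionSum C₁ R ∅ P (∑ u ∈ P, X.psi C₁ R u) = -∑ u ∈ P, X.psi C₁ R u := by
  rw [map_sum, ← Finset.sum_neg_distrib]
  refine Finset.sum_congr rfl fun v hv => ?_
  rw [reflectionSum_apply, Finset.sum_eq_single v]
  · rw [X.diffusion_psi C₁ R (Finset.notMem_empty v)]
    abel
  · intro u hu huv
    rw [X.diffusion_of_inner_eq_zero C₁ R fun _ =>
      X.inner_psi_eq_zero C₁ R huv (hP u hu v hv), sub_self]
  · exact fun h => absurd hv h

/-! ### The initial state -/

theorem norm_sq_afterMark (M : Finset V) (b : Bool) :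
    ‖X.afterMark M b‖ ^ 2 = ∑ u, if decide (u ∈ M) = b then X.σ u else 0 := by
  rw [EuclideanSpace.norm_sq_eq, Fintype.sum_sum_type]
  rw [← X.sum_supp (g := fun u => if decide (u ∈ M) = b then X.σ u else 0)
    (fun u hu => by simp [hu])]
  simp only [afterMark, initial, Sum.elim_inl, Sum.elim_inr, norm_zero]
  rw [Finset.sum_eq_zero (s := (Finset.univ : Finset X.graph.edgeSet)) (by simp), add_zero]
  refine Finset.sum_congr rfl fun s _ => ?_
  split_ifs
  · rw [Complex.norm_real, Real.norm_eq_abs, sq_abs, Real.sq_sqrt (X.σ_nonneg _)]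
  · simp

theorem norm_sq_afterMark_true (M : Finset V) :
    ‖X.afterMark M true‖ ^ 2 = ∑ u ∈ M, X.σ u := by
  rw [norm_sq_afterMark]
  simp [Finset.sum_ite_mem]

theorem norm_sq_afterMark_false (M : Finset V) :
    ‖X.afterMark M false‖ ^ 2 = 1 - ∑ u ∈ M, X.σ u := by
  rw [norm_sq_afterMark, ← X.σ_sum, eq_sub_iff_add_eq, ← Finset.sum_filter_add_sum_filter_not
    Finset.univ (· ∈ M) X.σ, Finset.sum_filter, Finset.sum_filter, Finset.sum_ite_mem,
    Finset.univ_inter, add_comm]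
  simp

theorem afterMark_empty : X.afterMark ∅ false = X.initial := by
  ext i
  rcases i with s | e <;> simp [afterMark, initial]

theorem sum_psi_inr (C₁ R : ℝ) {P : Finset V} {e : X.graph.edgeSet} {a b : V}
    (he : (e : Sym2 V) = s(a, b)) (ha : a ∈ P) (hb : b ∉ P) :
    (∑ u ∈ P, X.psi C₁ R u) (Sum.inr e) = ((√(X.w e) : ℝ) : ℂ) := by
  rw [WithLp.ofLp_sum, Finset.sum_apply, Finset.sum_eq_single a]
  · simp [psi, he]
  · intro u hu hua
    have hub : u ≠ b := fun h => hb (h ▸ hu)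
    simp [psi, he, hua, hub]
  · exact fun h => absurd ha h

theorem sum_psi_inl (C₁ R : ℝ) (P : Finset V) (s : {u : V // X.σ u ≠ 0}) :
    (∑ u ∈ P, X.psi C₁ R u) (Sum.inl s)
      = if (s : V) ∈ P then ((√(X.σ s / (C₁ * R)) : ℝ) : ℂ) else 0 := by
  rw [WithLp.ofLp_sum, Finset.sum_apply]
  simp [psi]

theorem initial_eq {C₁ R : ℝ} (hc : 0 < C₁ * R) :
    X.initial = ((√(C₁ * R) : ℝ) : ℂ) •
      (∑ u ∈ X.A, X.psi C₁ R u - ∑ u ∈ X.B, X.psi C₁ R u) := by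
  ext i
  rcases i with s | e
  · have hA := X.σ_supp _ s.2
    have hB := Finset.disjoint_left.1 X.disjoint_parts hA
    rw [PiLp.smul_apply, PiLp.sub_apply, sum_psi_inl, sum_psi_inl, if_pos hA, if_neg hB, sub_zero,
      smul_eq_mul, ← Complex.ofReal_mul, ← Real.sqrt_mul hc.le, mul_div_cancel₀ _ hc.ne']
    simp [initial]
  · obtain ⟨a, b, he, ha, ha', hb, hb'⟩ := X.exists_edge_ends e
    rw [PiLp.smul_apply, PiLp.sub_apply, X.sum_psi_inr C₁ R he ha hb',
      X.sum_psi_inr C₁ R (he.trans Sym2.eq_swap) hb ha']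
    simp [initial]

theorem norm_sq_sum_psi_A {C₁ R : ℝ} (hc : 0 < C₁ * R) :
    ‖∑ u ∈ X.A, X.psi C₁ R u‖ ^ 2 = 1 / (C₁ * R) + X.totalWeight := by
  rw [EuclideanSpace.norm_sq_eq, Fintype.sum_sum_type]
  congr 1
  · rw [← X.σ_sum, Finset.sum_div,
      ← X.sum_supp (g := fun u => X.σ u / (C₁ * R)) (fun u hu => by simp [hu])]
    refine Finset.sum_congr rfl fun s _ => ?_
    rw [sum_psi_inl, if_pos (X.σ_supp _ s.2), Complex.norm_real, Real.norm_eq_abs, sq_abs,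
      Real.sq_sqrt (div_nonneg (X.σ_nonneg _) hc.le)]
  · rw [totalWeight, ← X.sum_edgeSet]
    refine Finset.sum_congr rfl fun e _ => ?_
    obtain ⟨a, b, he, ha, ha', hb, hb'⟩ := X.exists_edge_ends e
    rw [X.sum_psi_inr C₁ R he ha hb', Complex.norm_real, Real.norm_eq_abs, sq_abs,
      Real.sq_sqrt (X.w_nonneg _ e.2)]

/-- With no marked vertex, the initial state is of the form `y - U y`, which is why it has little
weight on small phases. The vector `y` is negated by `R_A`, and `R_B` negates the difference between
`y` and a multiple of the initial state. -/
theorem initial_eq_sub_step {C₁ R : ℝ} (hc : 0 < C₁ * R) :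
    X.initial = ((√(C₁ * R) / 2 : ℝ) : ℂ) • (∑ u ∈ X.A, X.psi C₁ R u
      - X.step C₁ R ∅ (∑ u ∈ X.A, X.psi C₁ R u)) := by
  set y := ∑ u ∈ X.A, X.psi C₁ R u with hy
  set z := ∑ u ∈ X.B, X.psi C₁ R u with hz
  have hs : X.initial = ((√(C₁ * R) : ℝ) : ℂ) • (y - z) := X.initial_eq hc
  have hc' : ((√(C₁ * R) : ℝ) : ℂ) ≠ 0 := by
    exact_mod_cast (Real.sqrt_pos.2 hc).ne'
  have hyA : X.reflectionSum C₁ R ∅ X.A y = -y :=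
    X.reflectionSum_sum_psi C₁ R fun _ hu _ hv => X.not_adj_of_mem_A hu hv
  have hzB : X.reflectionSum C₁ R ∅ X.B z = -z :=
    X.reflectionSum_sum_psi C₁ R fun _ hu _ hv => X.not_adj_of_mem_B hu hv
  have hsB : X.reflectionSum C₁ R ∅ X.B X.initial = X.initial := by
    refine X.reflectionSum_of_inner_eq_zero C₁ R fun u hu _ => ?_
    rw [PiLp.inner_apply]
    refine Finset.sum_eq_zero fun i _ => ?_
    rcases i with s | e
    · have : (s : V) ≠ u := by
        intro h
        exact Finset.disjoint_left.1 X.disjoint_parts (X.σ_supp _ s.2) (h ▸ hu)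
      simp [psi, this]
    · simp [initial]
  have hyz : y = z + ((√(C₁ * R) : ℝ) : ℂ)⁻¹ • X.initial := by
    rw [hs, smul_smul, inv_mul_cancel₀ hc', one_smul]
    abel
  have hstep : X.step C₁ R ∅ y = z - ((√(C₁ * R) : ℝ) : ℂ)⁻¹ • X.initial := by
    rw [step, LinearMap.comp_apply, hyA, map_neg, hyz, map_add, map_smul, hzB, hsB]
    abel
  have hdiff : y - X.step C₁ R ∅ y = (2 * ((√(C₁ * R) : ℝ) : ℂ)⁻¹) • X.initial := by
    rw [hstep]
    nth_rw 1 [hyz]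
    module
  have hone : ((√(C₁ * R) / 2 : ℝ) : ℂ) * (2 * ((√(C₁ * R) : ℝ) : ℂ)⁻¹) = 1 := by
    push_cast
    field_simp
  rw [hdiff, smul_smul, hone, one_smul]

/-! ### Flows give fixed vectors of the walk -/

variable {X}

/-- The flow through an edge in the direction from `A` to `B`. -/
def Flow.across {M : Finset V} (f : X.Flow M) : Sym2 V → ℝ :=
  Sym2.lift ⟨fun u v => ((if u ∈ X.A then 1 else 0) - (if v ∈ X.A then 1 else 0)) * f.p u v,
    fun u v => by
      beta_reduce
      rw [f.antisymm u v]
      ring⟩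

theorem Flow.across_mk {M : Finset V} (f : X.Flow M) (u v : V) :
    f.across s(u, v)
      = ((if u ∈ X.A then 1 else 0) - (if v ∈ X.A then 1 else 0)) * f.p u v := rfl

theorem Flow.sq_across {M : Finset V} (f : X.Flow M) (e : X.graph.edgeSet) :
    f.across e ^ 2 = f.sq e := by
  obtain ⟨a, b, he, ha, ha', hb, hb'⟩ := X.exists_edge_ends e
  rw [he, f.across_mk, if_pos ha, if_neg hb', sub_zero, one_mul]
  rfl

theorem sum_incident (g : Sym2 V → ℝ) (u : V) :
    ∑ e : X.graph.edgeSet, (if u ∈ (e : Sym2 V) then g e else 0)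
      = ∑ v ∈ X.graph.neighborFinset u, g s(u, v) := by
  rw [X.sum_edgeSet (fun e => if u ∈ e then g e else 0), ← Finset.sum_filter]
  symm
  refine Finset.sum_bij (fun v _ => s(u, v)) ?_ ?_ ?_ ?_
  · intro v hv
    simpa using hv
  · intro v _ v' _ h
    exact Sym2.congr_right.1 h
  · intro e he
    simp only [Finset.mem_filter, SimpleGraph.mem_edgeFinset] at he
    obtain ⟨v, rfl⟩ := he.2
    exact ⟨v, by simpa using he.1, rfl⟩
  · intro v _
    rfl

theorem Flow.conservation_A {M : Finset V} (f : X.Flow M) {u : V} (hu : u ∈ X.A) (huM : u ∉ M) :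
    ∑ e : X.graph.edgeSet, (if u ∈ (e : Sym2 V) then f.across e else 0) = X.σ u := by
  rw [sum_incident, f.conservation u huM]
  refine Finset.sum_congr rfl fun v hv => ?_
  have hv' : v ∉ X.A := fun h => X.not_adj_of_mem_A hu h (by simpa using hv)
  rw [f.across_mk, if_pos hu, if_neg hv', sub_zero, one_mul]

theorem Flow.conservation_B {M : Finset V} (f : X.Flow M) {u : V} (hu : u ∈ X.B) (huM : u ∉ M) :
    ∑ e : X.graph.edgeSet, (if u ∈ (e : Sym2 V) then f.across e else 0) = X.σ u := by
  have huA : u ∉ X.A := Finset.disjoint_right.1 X.disjoint_parts hu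
  have h0 : X.σ u = 0 := by
    by_contra h
    exact huA (X.σ_supp u h)
  have hcons := f.conservation u huM
  rw [sum_incident, h0, ← neg_eq_zero, ← Finset.sum_neg_distrib, ← h0, hcons]
  refine Finset.sum_congr rfl fun v hv => ?_
  have hadj : X.graph.Adj u v := by simpa using hv
  have hv' : v ∈ X.A := by
    rcases X.bipartite.mem_of_adj hadj with h | h
    · exact absurd (by exact_mod_cast h.1) huA
    · exact_mod_cast h.2
  rw [f.across_mk, if_pos hv', if_neg huA]
  ring

theorem Flow.across_eq_zero {M : Finset V} {f : X.Flow M} (hf : f.energy ≠ ∞)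
    (e : X.graph.edgeSet) (he : X.w e = 0) : f.across e = 0 := by
  have hterm := ENNReal.sum_ne_top.1 hf e (SimpleGraph.mem_edgeFinset.2 e.2)
  rw [he, ENNReal.ofReal_zero] at hterm
  by_contra h
  refine hterm (ENNReal.div_zero ?_)
  rw [← f.sq_across, ENNReal.ofReal_ne_zero_iff]
  positivity

theorem Flow.sum_le_energy {M : Finset V} {f : X.Flow M} {r : ℝ} (hr : 0 ≤ r)
    (hf : f.energy ≤ ENNReal.ofReal r) :
    ∑ e : X.graph.edgeSet, (f.across e / √(X.w e)) ^ 2 ≤ r := by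
  have htop : f.energy ≠ ∞ := ne_top_of_le_ne_top ENNReal.ofReal_ne_top hf
  rw [← ENNReal.ofReal_le_ofReal_iff hr, ENNReal.ofReal_sum_of_nonneg (fun _ _ => sq_nonneg _)]
  refine le_trans (le_of_eq ?_) hf
  rw [Flow.energy, Finset.sum_subtype X.graph.edgeFinset (fun _ => SimpleGraph.mem_edgeFinset)]
  refine Finset.sum_congr rfl fun e _ => ?_
  rcases (X.w_nonneg e e.2).eq_or_lt with h | h
  · rw [← f.sq_across, f.across_eq_zero htop e h.symm]
    simp
  · rw [div_pow, Real.sq_sqrt h.le, f.sq_across, ENNReal.ofReal_div_of_pos h]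

theorem exists_flow_energy_le {M : Finset V} {R : ℝ} (hR : 0 < R)
    (h : X.effectiveResistance M ≤ ENNReal.ofReal R) :
    ∃ f : X.Flow M, f.energy ≤ ENNReal.ofReal (2 * R) := by
  have : X.effectiveResistance M < ENNReal.ofReal (2 * R) :=
    h.trans_lt ((ENNReal.ofReal_lt_ofReal_iff (by linarith)).2 (by linarith))
  obtain ⟨f, hf⟩ := iInf_lt_iff.1 this
  exact ⟨f, hf.le⟩

/-- By Cauchy–Schwarz, a flow that carries the mass `q` away from the unmarked vertices has energy
at least `q ^ 2 / W`. -/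
theorem Flow.sq_norm_afterMark_le {M : Finset V} {f : X.Flow M} {r : ℝ} (hr : 0 ≤ r)
    (hf : f.energy ≤ ENNReal.ofReal r) :
    (‖X.afterMark M false‖ ^ 2) ^ 2 ≤ X.totalWeight * r := by
  have htop : f.energy ≠ ∞ := ne_top_of_le_ne_top ENNReal.ofReal_ne_top hf
  have h1 : ‖X.afterMark M false‖ ^ 2
      ≤ ∑ e : X.graph.edgeSet, √(X.w e) * |f.across e / √(X.w e)| := by
    calc ‖X.afterMark M false‖ ^ 2 = ∑ u ∈ X.A \ M, X.σ u := by
          rw [norm_sq_afterMark, ← Finset.sum_filter]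
          symm
          refine Finset.sum_subset (fun u hu => by simpa using (Finset.mem_sdiff.1 hu).2) ?_
          intro u hu huA
          by_contra h
          refine huA (Finset.mem_sdiff.2 ⟨X.σ_supp u h, by simpa using hu⟩)
      _ = ∑ e : X.graph.edgeSet, ∑ u ∈ X.A \ M,
            (if u ∈ (e : Sym2 V) then f.across e else 0) := by
          rw [Finset.sum_comm]
          refine Finset.sum_congr rfl fun u hu => ?_
          rw [f.conservation_A (Finset.mem_sdiff.1 hu).1 (Finset.mem_sdiff.1 hu).2]
      _ ≤ ∑ e : X.graph.edgeSet, √(X.w e) * |f.across e / √(X.w e)| := by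
          refine Finset.sum_le_sum fun e _ => ?_
          obtain ⟨a, b, he, ha, ha', hb, hb'⟩ := X.exists_edge_ends e
          have h2 : ∑ u ∈ X.A \ M, (if u ∈ (e : Sym2 V) then f.across e else 0)
              = if a ∈ X.A \ M then f.across e else 0 := by
            rw [← Finset.sum_ite_eq' (X.A \ M) a fun _ => f.across e]
            refine Finset.sum_congr rfl fun u hu => ?_
            have hub : u ≠ b := fun h => hb' (h ▸ (Finset.mem_sdiff.1 hu).1)
            simp [he, hub]
          have h3 : √(X.w e) * |f.across e / √(X.w e)| = |f.across e| := by
            rcases (X.w_nonneg e e.2).eq_or_lt with h | h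
            · simp [f.across_eq_zero htop e h.symm]
            · have := Real.sqrt_pos.2 h
              rw [abs_div, abs_of_pos this, mul_div_cancel₀ _ this.ne']
          rw [h2, h3]
          split_ifs
          · exact le_abs_self _
          · exact abs_nonneg _
  calc (‖X.afterMark M false‖ ^ 2) ^ 2
      ≤ (∑ e : X.graph.edgeSet, √(X.w e) * |f.across e / √(X.w e)|) ^ 2 := by gcongr
    _ ≤ (∑ e : X.graph.edgeSet, √(X.w e) ^ 2)
        * ∑ e : X.graph.edgeSet, |f.across e / √(X.w e)| ^ 2 :=
          Finset.sum_mul_sq_le_sq_mul_sq _ _ _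
    _ ≤ X.totalWeight * r := by
        have hW : ∑ e : X.graph.edgeSet, √(X.w e) ^ 2 = X.totalWeight := by
          rw [totalWeight, ← X.sum_edgeSet]
          exact Finset.sum_congr rfl fun e _ => Real.sq_sqrt (X.w_nonneg e e.2)
        rw [hW]
        refine mul_le_mul_of_nonneg_left ?_ (Finset.sum_nonneg fun e he =>
          X.w_nonneg e (SimpleGraph.mem_edgeFinset.1 he))
        simpa only [sq_abs] using Flow.sum_le_energy hr hf

/-- The part `∑ p_e / √w_e |e⟩` of the walk space that encodes a flow `p`, with the edges oriented
from `A` to `B`. -/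
def Flow.edgeVector {M : Finset V} (f : X.Flow M) : X.Space :=
  WithLp.toLp 2 (Sum.elim (fun _ => 0) fun e => ((f.across e / √(X.w e) : ℝ) : ℂ))

/-- The vector `√(C₁ R) ∑ √σ_u |u⟩ - ∑ p_e / √w_e |e⟩` of a flow `p`, where `u` runs over the
unmarked vertices. -/
def Flow.vector {M : Finset V} (f : X.Flow M) (C₁ R : ℝ) : X.Space :=
  ((√(C₁ * R) : ℝ) : ℂ) • X.afterMark M false
    - f.edgeVector

/-- The conservation law at `u` says that the vector of the flow is orthogonal to `ψ_u`. -/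
theorem Flow.inner_psi_vector {M : Finset V} {f : X.Flow M} {C₁ R : ℝ} (hc : 0 < C₁ * R)
    (hf : f.energy ≠ ∞) {u : V} (huM : u ∉ M)
    (hu : ∑ e : X.graph.edgeSet, (if u ∈ (e : Sym2 V) then f.across e else 0) = X.σ u) :
    inner ℂ (X.psi C₁ R u) (f.vector C₁ R) = 0 := by
  rw [PiLp.inner_apply, Fintype.sum_sum_type]
  have h1 : ∑ s : {u : V // X.σ u ≠ 0}, inner ℂ (X.psi C₁ R u (Sum.inl s))
      (f.vector C₁ R (Sum.inl s)) = ((X.σ u : ℝ) : ℂ) := by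
    have : ∀ s : {u : V // X.σ u ≠ 0}, inner ℂ (X.psi C₁ R u (Sum.inl s))
        (f.vector C₁ R (Sum.inl s)) = (((if (s : V) = u then X.σ s else 0 : ℝ)) : ℂ) := by
      intro s
      by_cases hs : (s : V) = u
      · have hsM : (s : V) ∉ M := hs ▸ huM
        simp only [psi, Flow.vector, Flow.edgeVector, afterMark, initial, PiLp.sub_apply, PiLp.smul_apply,
          Sum.elim_inl, hs, huM, if_true, decide_false, RCLike.inner_apply, smul_eq_mul, sub_zero,
          Complex.conj_ofReal]
        rw [← Complex.ofReal_mul, ← Complex.ofReal_mul, ← Real.sqrt_mul hc.le, mul_comm,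
          ← Real.sqrt_mul (div_nonneg (X.σ_nonneg u) hc.le), ← mul_assoc,
          div_mul_cancel₀ _ hc.ne', Real.sqrt_mul_self (X.σ_nonneg u)]
      · simp [psi, hs]
    rw [Finset.sum_congr rfl fun s _ => this s, ← Complex.ofReal_sum,
      X.sum_supp (g := fun v => if v = u then X.σ v else 0) (fun v hv => by simp [hv])]
    simp
  have h2 : ∑ e : X.graph.edgeSet, inner ℂ (X.psi C₁ R u (Sum.inr e))
      (f.vector C₁ R (Sum.inr e)) = -((X.σ u : ℝ) : ℂ) := by
    rw [← hu, Complex.ofReal_sum, ← Finset.sum_neg_distrib]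
    refine Finset.sum_congr rfl fun e _ => ?_
    by_cases he : u ∈ (e : Sym2 V)
    · simp only [psi, Flow.vector, Flow.edgeVector, afterMark, PiLp.sub_apply, PiLp.smul_apply,
        Sum.elim_inr, he, if_true, RCLike.inner_apply, smul_eq_mul, mul_zero, zero_sub,
        Complex.conj_ofReal]
      rw [neg_mul, ← Complex.ofReal_mul]
      congr 2
      rcases (X.w_nonneg e e.2).eq_or_lt with h | h
      · simp [f.across_eq_zero hf e h.symm]
      · exact div_mul_cancel₀ _ (Real.sqrt_pos.2 h).ne'
    · simp [psi, he]
  rw [h1, h2, add_neg_cancel]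

theorem Flow.step_vector {M : Finset V} {f : X.Flow M} {C₁ R : ℝ} (hc : 0 < C₁ * R)
    (hf : f.energy ≠ ∞) : X.step C₁ R M (f.vector C₁ R) = f.vector C₁ R := by
  rw [step, LinearMap.comp_apply, X.reflectionSum_of_inner_eq_zero C₁ R fun u hu huM =>
      Flow.inner_psi_vector hc hf huM (f.conservation_A hu huM),
    X.reflectionSum_of_inner_eq_zero C₁ R fun u hu huM =>
      Flow.inner_psi_vector hc hf huM (f.conservation_B hu huM)]

theorem Flow.inner_afterMark_edgeVector {M : Finset V} (f : X.Flow M) (b : Bool) :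
    inner ℂ (X.afterMark M b) f.edgeVector = 0 := by
  rw [PiLp.inner_apply]
  refine Finset.sum_eq_zero fun i _ => ?_
  rcases i with s | e
  · simp [edgeVector]
  · simp [afterMark]

theorem Flow.inner_vector_afterMark {M : Finset V} (f : X.Flow M) (C₁ R : ℝ) :
    inner ℂ (f.vector C₁ R) (X.afterMark M false)
      = ((√(C₁ * R) * ‖X.afterMark M false‖ ^ 2 : ℝ) : ℂ) := by
  rw [Flow.vector, inner_sub_left, inner_smul_left,
    inner_eq_zero_symm.1 (f.inner_afterMark_edgeVector false), inner_self_eq_norm_sq_to_K]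
  simp

theorem Flow.norm_sq_vector_le {M : Finset V} {f : X.Flow M} {C₁ R r : ℝ} (hc : 0 < C₁ * R)
    (hr : 0 ≤ r) (hf : f.energy ≤ ENNReal.ofReal r) :
    ‖f.vector C₁ R‖ ^ 2 ≤ C₁ * R * ‖X.afterMark M false‖ ^ 2 + r := by
  have hE : ‖f.edgeVector‖ ^ 2 ≤ r := by
    rw [EuclideanSpace.norm_sq_eq, Fintype.sum_sum_type]
    refine le_of_eq_of_le ?_ (Flow.sum_le_energy hr hf)
    simp [edgeVector, div_pow]
  rw [Flow.vector, @norm_sub_sq ℂ, inner_smul_left, f.inner_afterMark_edgeVector, norm_smul,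
    mul_pow, Complex.norm_real, Real.norm_eq_abs, sq_abs, Real.sq_sqrt hc.le, mul_zero, map_zero,
    mul_zero, sub_zero]
  linarith

end Network

/-! ### The output probabilities -/

/-- On vectors of phase near `θ` the operator `1 - U` has norm about `|θ|`, so phase estimation with
precision `δ` on the state `y - U y` reports a phase in the window of radius `δ` with weight
`O(δ ^ 2)`. -/
theorem sum_phaseEstimation_sub_le {H : Type*} [NormedAddCommGroup H] [InnerProductSpace ℂ H]
    {U : H →ₗ[ℂ] H} (hU : ∀ x, ‖U x‖ = ‖x‖) (y : H) {δ : ℝ} (hδ : 0 < δ) (hδ1 : δ ≤ 1) :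
    ∑ k : Fin (registerSize δ) with |reportedPhase k| ≤ δ,
      ‖runCircuit U (phaseEstimation (registerSize δ)) (y - U y) k‖ ^ 2 ≤ 3 * δ ^ 2 * ‖y‖ ^ 2 := by
  have hpi := Real.pi_gt_three
  have hTge : 16 * Real.pi / δ ≤ (registerSize δ : ℝ) := Nat.le_ceil _
  have hTlt : (registerSize δ : ℝ) < 16 * Real.pi / δ + 1 := Nat.ceil_lt_add_one (by positivity)
  generalize registerSize δ = T at *
  have hT48 : 48 ≤ δ * T := by
    have := (div_le_iff₀ hδ).1 hTge
    linarith
  have hTpos : (0 : ℝ) < T := by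
    by_contra h
    nlinarith [not_lt.1 h]
  have : NeZero T := ⟨by rintro rfl; simp at hTpos⟩
  -- The window of radius `δ` has radius `δ T / (2 π) ≤ 8 + δ / (2 π) < 9` in grid points.
  have hcard : (Finset.univ.filter fun k : Fin T => |reportedPhase k| ≤ δ).card ≤ 2 * 9 := by
    apply card_reportedPhase_le
    · have : δ * T < δ * (16 * Real.pi / δ + 1) := mul_lt_mul_of_pos_left hTlt hδ
      rw [mul_add, mul_div_cancel₀ _ hδ.ne'] at this
      push_cast
      linarith
    · have : (9 : ℝ) ≤ T := by nlinarith
      exact_mod_cast this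
  have hinv : 2 * ‖y‖ / T ≤ δ * ‖y‖ / 24 := by
    rw [div_le_iff₀ hTpos]
    nlinarith [norm_nonneg y]
  set a : Fin T → H := runCircuit U (phaseEstimation T) y with ha
  have hterm : ∀ k ∈ Finset.univ.filter fun k : Fin T => |reportedPhase k| ≤ δ,
      ‖runCircuit U (phaseEstimation T) (y - U y) k‖ ^ 2
        ≤ 2 * δ ^ 2 * ‖a k‖ ^ 2 + δ ^ 2 * ‖y‖ ^ 2 / 288 := by
    intro k hk
    have hk' : |reportedPhase k| ≤ δ := by simpa using hk
    have h : ‖runCircuit U (phaseEstimation T) (y - U y) k‖ ≤ δ * ‖a k‖ + δ * ‖y‖ / 24 :=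
      (norm_phaseEstimation_sub_le hU y k).trans
        (add_le_add (mul_le_mul_of_nonneg_right hk' (norm_nonneg _)) hinv)
    calc ‖runCircuit U (phaseEstimation T) (y - U y) k‖ ^ 2
        ≤ (δ * ‖a k‖ + δ * ‖y‖ / 24) ^ 2 := by gcongr
      _ ≤ 2 * δ ^ 2 * ‖a k‖ ^ 2 + δ ^ 2 * ‖y‖ ^ 2 / 288 := by
          nlinarith [sq_nonneg (δ * ‖a k‖ - δ * ‖y‖ / 24)]
  have hsum : ∑ k : Fin T with |reportedPhase k| ≤ δ, ‖a k‖ ^ 2 ≤ ‖y‖ ^ 2 := by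
    rw [← sum_norm_sq_runCircuit hU (phaseEstimation T) y]
    exact Finset.sum_le_sum_of_subset_of_nonneg (Finset.filter_subset _ _)
      fun _ _ _ => sq_nonneg _
  have hcard' : ((Finset.univ.filter fun k : Fin T => |reportedPhase k| ≤ δ).card : ℝ) ≤ 18 := by
    exact_mod_cast hcard
  refine (Finset.sum_le_sum hterm).trans ?_
  rw [Finset.sum_add_distrib, ← Finset.mul_sum, Finset.sum_const, nsmul_eq_mul]
  have h1 := mul_le_mul_of_nonneg_left hsum (by positivity : (0 : ℝ) ≤ 2 * δ ^ 2)
  have h2 := mul_le_mul_of_nonneg_right hcard' (by positivity : 0 ≤ δ ^ 2 * ‖y‖ ^ 2 / 288)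
  have h3 : 0 ≤ δ ^ 2 * ‖y‖ ^ 2 := by positivity
  linarith

namespace Network

variable {V : Type*} [Fintype V] {X : Network V}

/-- This bounds the precision of the algorithm: a resistance `R` that is too small for the weight `W`
is impossible unless most of the initial mass is marked. -/
theorem le_mul_totalWeight {M : Finset V} {R : ℝ} (hR : 0 < R)
    (hM : X.effectiveResistance M ≤ ENNReal.ofReal R) (hσ : ∑ u ∈ M, X.σ u < 2 / 3) :
    1 / 18 ≤ R * X.totalWeight := by
  obtain ⟨f, hf⟩ := exists_flow_energy_le hR hM
  have h := Flow.sq_norm_afterMark_le (by linarith) hf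
  rw [norm_sq_afterMark_false] at h
  nlinarith

/-- If marked vertices exist, a flow gives a fixed vector of the walk, and the overlap of the initial
state with it is large. -/
theorem two_thirds_le_probYes {M : Finset V} {C R : ℝ} (hC : 0 < C) (hR : 0 < R)
    (hM : X.effectiveResistance M ≤ ENNReal.ofReal R) : 2 / 3 ≤ X.probYes 6 C R M := by
  rw [probYes, norm_sq_afterMark_true]
  have hnn : ∀ s : Finset (Fin (registerSize (X.precision C R))),
      0 ≤ ∑ k ∈ s, X.outcomeProb 6 C R M k := fun s => Finset.sum_nonneg fun _ _ => sq_nonneg _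
  by_cases hσ : 2 / 3 ≤ ∑ u ∈ M, X.σ u
  · linarith [hnn (Finset.univ.filter fun k => |reportedPhase k| ≤ X.precision C R)]
  have hRW : 1 / 18 ≤ R * X.totalWeight := le_mul_totalWeight hR hM (not_le.1 hσ)
  have hδ : 0 < X.precision C R := by
    have : 0 < √(R * X.totalWeight) := Real.sqrt_pos.2 (by linarith)
    rw [precision]
    positivity
  have : NeZero (registerSize (X.precision C R)) := by
    refine ⟨(Nat.ceil_pos.2 ?_).ne'⟩
    have := Real.pi_pos
    positivity
  have hmem : (0 : Fin (registerSize (X.precision C R))) ∈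
      Finset.univ.filter fun k => |reportedPhase k| ≤ X.precision C R := by
    refine Finset.mem_filter.2 ⟨Finset.mem_univ _, ?_⟩
    simp [reportedPhase, hδ.le]
  have hle := Finset.single_le_sum (f := X.outcomeProb 6 C R M) (fun _ _ => sq_nonneg _) hmem
  obtain ⟨f, hf⟩ := exists_flow_energy_le hR hM
  -- With `q` the unmarked mass, the overlap gives `p ≥ 6 R q ^ 2 / (6 R q + 2 R) ≥ q - 1 / 3`.
  have hc : 0 < 6 * R := by linarith
  have hv := f.norm_sq_vector_le hc (by linarith) hf
  have hover := norm_inner_le_phaseEstimation_zero (T := registerSize (X.precision C R))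
    (X.norm_step 6 R M)
    (Flow.step_vector hc (ne_top_of_le_ne_top ENNReal.ofReal_ne_top hf)) (X.afterMark M false)
  rw [f.inner_vector_afterMark, Complex.norm_real, Real.norm_eq_abs] at hover
  have hp : X.outcomeProb 6 C R M 0
    = ‖runCircuit (X.step 6 R M) (phaseEstimation (registerSize (X.precision C R)))
        (X.afterMark M false) 0‖ ^ 2 := rfl
  have hover2 := pow_le_pow_left₀ (abs_nonneg _) hover 2
  rw [sq_abs, mul_pow, mul_pow, Real.sq_sqrt hc.le, ← hp] at hover2
  have hq := X.norm_sq_afterMark_false M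
  set q := ‖X.afterMark M false‖ ^ 2 with hqdef
  set p := X.outcomeProb 6 C R M 0 with hpdef
  have hp0 : 0 ≤ p := sq_nonneg _
  have hq0 : 1 / 3 < q := by linarith [not_le.1 hσ]
  have h1 : 6 * R * q ^ 2 ≤ (6 * R * q + 2 * R) * p :=
    hover2.trans (mul_le_mul_of_nonneg_right hv hp0)
  have h2 : 3 * q ^ 2 ≤ (3 * q + 1) * p := by
    have : 2 * R * (3 * q ^ 2) ≤ 2 * R * ((3 * q + 1) * p) := by linarith
    exact le_of_mul_le_mul_left this (by linarith)
  have h3 : q - 1 / 3 ≤ p := by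
    have : (3 * q + 1) * (q - 1 / 3) ≤ (3 * q + 1) * p := by nlinarith
    exact le_of_mul_le_mul_left this (by linarith)
  linarith

/-- With no marked vertex the initial state is `y - U y` with `‖y‖ ^ 2 = (1 + C₁ R W) / 4`, and
`δ ^ 2 ‖y‖ ^ 2` is small when the constant `C` is large compared with `C₁` and `R W` is bounded
below. -/
theorem two_thirds_le_probNo {R : ℝ} (hR : 0 < R) (hRW : 1 / 18 ≤ R * X.totalWeight) :
    2 / 3 ≤ X.probNo 6 10 R ∅ := by
  have hc : 0 < 6 * R := by linarith
  have hs : 0 < √(R * X.totalWeight) := Real.sqrt_pos.2 (by linarith)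
  have hδ : 0 < X.precision 10 R := by
    rw [precision]
    positivity
  have hδ2 : X.precision 10 R ^ 2 = 1 / (100 * (R * X.totalWeight)) := by
    rw [precision, div_pow, mul_pow, Real.sq_sqrt (by linarith)]
    norm_num
  have hδ1 : X.precision 10 R ≤ 1 := by
    rw [← sq_le_one_iff₀ hδ.le, hδ2, div_le_one (by linarith)]
    linarith
  have : NeZero (registerSize (X.precision 10 R)) := by
    refine ⟨(Nat.ceil_pos.2 ?_).ne'⟩
    have := Real.pi_pos
    positivity
  have htot : ∑ k, X.outcomeProb 6 10 R ∅ k = 1 := by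
    simp only [outcomeProb]
    rw [sum_norm_sq_runCircuit (X.norm_step 6 R ∅), norm_sq_afterMark_false]
    simp
  set y : X.Space := ((√(6 * R) / 2 : ℝ) : ℂ) • ∑ u ∈ X.A, X.psi 6 R u with hy
  have hinit : X.afterMark ∅ false = y - X.step 6 R ∅ y := by
    rw [afterMark_empty, X.initial_eq_sub_step hc, hy, map_smul, smul_sub]
  have hwin : ∑ k with |reportedPhase k| ≤ X.precision 10 R, X.outcomeProb 6 10 R ∅ k
      ≤ 3 * X.precision 10 R ^ 2 * ‖y‖ ^ 2 := by
    simp only [outcomeProb, hinit]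
    exact sum_phaseEstimation_sub_le (X.norm_step 6 R ∅) y hδ hδ1
  have hynorm : ‖y‖ ^ 2 = (1 + 6 * (R * X.totalWeight)) / 4 := by
    rw [hy, norm_smul, mul_pow, X.norm_sq_sum_psi_A hc, Complex.norm_real, Real.norm_eq_abs, sq_abs,
      div_pow, Real.sq_sqrt hc.le]
    field_simp
    ring
  have hsmall : 3 * X.precision 10 R ^ 2 * ‖y‖ ^ 2 ≤ 1 / 3 := by
    rw [hδ2, hynorm, mul_one_div, div_mul_div_comm, div_le_div_iff₀ (by linarith) (by norm_num)]
    linarith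
  have hsplit := Finset.sum_filter_add_sum_filter_not Finset.univ
    (fun k : Fin (registerSize (X.precision 10 R)) => |reportedPhase k| ≤ X.precision 10 R)
    (X.outcomeProb 6 10 R ∅)
  rw [probNo]
  linarith

theorem walkSteps_le {C R : ℝ} (hC : 0 < C) :
    (X.walkSteps C R : ℝ) ≤ 16 * Real.pi * C * √(R * X.totalWeight) := by
  rw [walkSteps, circuit, steps_phaseEstimation, registerSize, precision, div_div_eq_mul_div, div_one,
    ← mul_assoc]
  have h : 0 ≤ 16 * Real.pi * C * √(R * X.totalWeight) := by
    have := Real.pi_pos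
    positivity
  have hlt := Nat.ceil_lt_add_one h
  generalize ⌈16 * Real.pi * C * √(R * X.totalWeight)⌉₊ = n at *
  rcases n with _ | n
  · simpa using h
  · push_cast at hlt
    simp only [Nat.add_sub_cancel]
    linarith

end Network

end QuantumWalk

end

theorem theorem3p1 :
    ∃ C₁ C K : ℝ, 0 < C₁ ∧ 0 < C ∧ 0 < K ∧
      ∀ (V : Type*) [Fintype V] (X : QuantumWalk.Network V) (R : ℝ) (𝓜 : Set (Finset V)),
        0 < R →
        (∀ M ∈ 𝓜, M.Nonempty → X.effectiveResistance M ≤ ENNReal.ofReal R) →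
        (∀ M ∈ 𝓜, M.Nonempty → 2 / 3 ≤ X.probYes C₁ C R M) ∧
        ((∃ M ∈ 𝓜, M.Nonempty ∧ ∑ u ∈ M, X.σ u < 2 / 3) → 2 / 3 ≤ X.probNo C₁ C R ∅) ∧
        (X.walkSteps C R : ℝ) ≤ K * √(R * X.totalWeight) := by
  have hpi := Real.pi_pos
  refine ⟨6, 10, 16 * Real.pi * 10, by norm_num, by norm_num, by positivity, ?_⟩
  intro V _ X R 𝓜 hR hres
  refine ⟨fun M hM hne => ?_, ?_, ?_⟩
  · exact QuantumWalk.Network.two_thirds_le_probYes (by norm_num) hR (hres M hM hne)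
  · rintro ⟨M, hM, hne, hσ⟩
    exact QuantumWalk.Network.two_thirds_le_probNo hR
      (QuantumWalk.Network.le_mul_totalWeight hR (hres M hM hne) hσ)
  · exact QuantumWalk.Network.walkSteps_le (by norm_num)
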